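/- Let $p\ge 1$ be a real number and let $E$ be a $\sigma$-Dedekind complete (real) Banach lattice, that is, a Banach lattice in which every nonempty countable set that is bounded above has a supremum. Let $E^*$ be its dual Banach lattice. A sequence in a Banach lattice is disjoint if $|x_m|\wedge|x_n|=0$ for all $m\neq n$; a sequence $(x_n)_n$ in $E$ is weakly $p$-summable if $\sum_n |x^*(x_n)|^p<\infty$ for every $x^*\in E^*$. A set $A\subseteq E$ is limited if every weak* null sequence in $E^*$ converges to zero uniformly on $A$; a bounded set $A\subseteq E$ is almost limited if every disjoint weak* null sequence in $E^*$ converges to zero uniformly on $A$. A sequence is called limited (almost limited) if its set of terms is. Then the following are equivalent: (a) $E$ has the disjoint Dunford-Pettis* property of order $p$ (disjoint $DP^*P_p$), that is, every disjoint weakly $p$-summable sequence in $E$ is limited. (b) Every disjoint weakly $p$-summable sequence in $E$ is almost limited. (c) For every disjoint weakly $p$-summable sequence $(x_n)_n$ in $E$ and every disjoint weak* null sequence $(x_n^*)_n$ in $E^*$, we have $x_n^*(x_n)\to 0$. (d) For every disjoint weakly $p$-summable sequence $(x_n)_n$ in $E$ and every positive disjoint weak* null sequence $(x_n^*)_n$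 in $E^*$, we have $x_n^*(x_n)\to 0$. (e) For every disjoint weakly $p$-summable sequence $(x_n)_n$ in $E$ and every positive weak* null sequence $(x_n^*)_n$ in $E^*$, we have $x_n^*(x_n)\to 0$. -/

import Mathlib

open Filter Topology

section Dual

variable {E : Type*} [NormedAddCommGroup E] [Lattice E] [IsOrderedAddMonoid E] [NormedSpace ℝ E]

/-- The canonical order of the dual of a Banach lattice: `f ≤ g` iff `f x ≤ g x` for every
`x ≥ 0`. -/
instance dualPartialOrder : PartialOrder (StrongDual ℝ E) where
  le f g := ∀ x : E, 0 ≤ x → f x ≤ g x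
  le_refl f x _ := le_refl (f x)
  le_trans f g h hfg hgh x hx := (hfg x hx).trans (hgh x hx)
  le_antisymm f g hfg hgf := by
    ext x
    have key : ∀ y : E, 0 ≤ y → f y = g y := fun y hy => le_antisymm (hfg y hy) (hgf y hy)
    rw [← posPart_sub_negPart x, map_sub, map_sub, key _ (posPart_nonneg x),
      key _ (negPart_nonneg x)]

/-- Two functionals on a Banach lattice are disjoint in the dual lattice: `|f| ∧ |g| = 0`, where
`|f| = f ∨ (-f)`, and the lattice operations are the suprema and infima for the canonical order
of the dual. (By the Riesz-Kantorovich theorem all of these exist.) -/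
def DualDisjoint (f g : StrongDual ℝ E) : Prop :=
  ∃ u v : StrongDual ℝ E, IsLUB {f, -f} u ∧ IsLUB {g, -g} v ∧ IsGLB {u, v} 0

/-- A sequence of pairwise disjoint functionals. -/
def DisjointDualSeq (f : ℕ → StrongDual ℝ E) : Prop :=
  Pairwise fun m n => DualDisjoint (f m) (f n)

end Dual

/-- A sequence of pairwise disjoint elements of a vector lattice: `|x m| ∧ |x n| = 0` for
`m ≠ n`. -/
def DisjointSeq {E : Type*} [AddCommGroup E] [Lattice E] (x : ℕ → E) : Prop :=
  Pairwise fun m n => |x m| ⊓ |x n| = 0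

/-- Every nonempty countable subset that is bounded above has a supremum. -/
def SigmaDedekindComplete (E : Type*) [Lattice E] : Prop :=
  ∀ s : Set E, s.Countable → s.Nonempty → BddAbove s → ∃ a, IsLUB s a

section Space

variable {E : Type*} [NormedAddCommGroup E] [NormedSpace ℝ E]

/-- The scalar sequence `(f (x n))` belongs to `ℓ_p` for every `f` in the dual. -/
def WeaklyPSummable (p : ℝ) (x : ℕ → E) : Prop :=
  ∀ f : StrongDual ℝ E, Summable fun n => |f (x n)| ^ p

/-- The sequence `f` tends to `0` in the weak* topology. -/
def WeakStarNull (f : ℕ → StrongDual ℝ E) : Prop :=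
  Tendsto (fun n => StrongDual.toWeakDual (f n)) atTop (𝓝 0)

/-- A set on which every weak* null sequence converges uniformly to zero. -/
def IsLimitedSet (A : Set E) : Prop :=
  ∀ f : ℕ → StrongDual ℝ E, WeakStarNull f →
    TendstoUniformlyOn (fun n x => f n x) (fun _ => 0) atTop A

end Space

/-- A bounded set on which every disjoint weak* null sequence converges uniformly to zero. -/
def IsAlmostLimitedSet {E : Type*} [NormedAddCommGroup E] [Lattice E] [IsOrderedAddMonoid E]
    [NormedSpace ℝ E] (A : Set E) : Prop :=
  Bornology.IsBounded A ∧
    ∀ f : ℕ → StrongDual ℝ E, DisjointDualSeq f → WeakStarNull f →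
      TendstoUniformlyOn (fun n x => f n x) (fun _ => 0) atTop A

/-- The disjoint Dunford-Pettis* property of order `p`: every disjoint weakly `p`-summable
sequence is limited. -/
def DisjointDPStarP (p : ℝ) (E : Type*) [NormedAddCommGroup E] [Lattice E]
    [NormedSpace ℝ E] : Prop :=
  ∀ x : ℕ → E, DisjointSeq x → WeaklyPSummable p x → IsLimitedSet (Set.range x)

/-! Only (d) ⇒ (a) has substance. Both disjointness and weak `p`-summability pass to subsequences,
so `isLimitedSet_range_of_subseq` reduces (a) to diagonals: `f n (x n) → 0` for every weak* null
`f`. Such an `f` need be neither positive nor disjoint, so it is replaced by `g n = idealPosPart (f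
n) (x n)⁺`, the positive part of `f n` on the ideal generated by `(x n)⁺`. These functionals are
positive and pairwise disjoint, and `f n (x n)⁺ ≤ g n (x n)`.

The crux is that `g` is again weak* null. For `x ≥ 0`, `g n x` is nearly `f n (z n)`, where `0 ≤ z n
≤ x` and the `z n` are disjoint. By `σ`-Dedekind completeness every set `A` of indices has a
supremum `s A` of the `z n` with `n ∈ A`, so `A ↦ f n (s A)` is bounded, finitely additive, and
tends to zero for each `A`. Phillips' lemma then gives `f n (z n) → 0`. Now (d) bounds `f n (x n)⁺`
above by a null sequence; using `-f` and `-x` as well finishes the argument. -/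

/-! ### A form of Phillips' lemma for finitely additive set functions on `ℕ` -/

/-- A bounded finitely additive set function is arbitrarily small on some infinite subset of any
infinite set. -/
theorem exists_infinite_subset_forall_abs_lt {μ : Set ℕ → ℝ} {C δ : ℝ}
    (hadd : ∀ A B, Disjoint A B → μ (A ∪ B) = μ A + μ B) (hC : ∀ A, |μ A| ≤ C)
    (hδ : 0 < δ) {M : Set ℕ} (hM : M.Infinite) :
    ∃ M' ⊆ M, M'.Infinite ∧ ∀ B ⊆ M', |μ B| < δ := by
  by_contra! hcon
  let e := hM.natEmbedding
  -- The pairing function cuts `M` into infinitely many disjoint infinite pieces, each containing a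
  -- set on which `|μ|` is at least `δ`.
  let q : ℕ → Set ℕ := fun i => Set.range fun k => (e (Nat.pair i k) : ℕ)
  have hq : ∀ i, ∃ B ⊆ q i, δ ≤ |μ B| := by
    intro i
    refine hcon (q i) ?_ ?_
    · rintro _ ⟨k, rfl⟩
      exact (e _).2
    · refine Set.infinite_range_of_injective fun a b hab => ?_
      have := e.injective (Subtype.ext hab)
      simpa using this
  choose B hB hδB using hq
  have hdisj : ∀ i j, i ≠ j → Disjoint (B i) (B j) := by
    intro i j hij
    rw [Set.disjoint_left]
    intro a hai haj
    obtain ⟨k, hk⟩ := hB i hai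
    obtain ⟨l, hl⟩ := hB j haj
    have := e.injective (Subtype.ext (hk.trans hl.symm))
    simp only [Nat.pair_eq_pair] at this
    exact hij this.1
  have h0 : μ ∅ = 0 := by
    have := hadd ∅ ∅ (by simp)
    simp only [Set.union_self] at this
    linarith
  have hsum : ∀ s : Finset ℕ, μ (⋃ i ∈ s, B i) = ∑ i ∈ s, μ (B i) := by
    intro s
    induction s using Finset.induction_on with
    | empty => simpa using h0
    | insert a s ha ih =>
      rw [Finset.sum_insert ha, Finset.set_biUnion_insert, hadd, ih]
      rw [Set.disjoint_iUnion₂_right]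
      exact fun i hi => hdisj a i (by rintro rfl; exact ha hi)
  have key : ∀ s : Finset ℕ, ∑ i ∈ s, |μ (B i)| ≤ 2 * C := by
    intro s
    -- Each sign class sums to `μ` of a single union, hence contributes at most `C`.
    rw [← Finset.sum_filter_add_sum_filter_not s (fun i => 0 ≤ μ (B i))]
    have h1 : ∑ i ∈ s with 0 ≤ μ (B i), |μ (B i)| ≤ C := by
      rw [Finset.sum_congr rfl fun i hi => abs_of_nonneg (Finset.mem_filter.1 hi).2, ← hsum]
      exact (le_abs_self _).trans (hC _)
    have h2 : ∑ i ∈ s with ¬ 0 ≤ μ (B i), |μ (B i)| ≤ C := by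
      rw [Finset.sum_congr rfl fun i hi => abs_of_neg (not_le.1 (Finset.mem_filter.1 hi).2),
        Finset.sum_neg_distrib, ← hsum]
      exact (neg_le_abs _).trans (hC _)
    linarith
  obtain ⟨K, hK⟩ := exists_nat_gt (2 * C / δ)
  have h1 := key (Finset.range K)
  have h2 : (K : ℝ) * δ ≤ ∑ i ∈ Finset.range K, |μ (B i)| := by
    simpa using Finset.card_nsmul_le_sum (Finset.range K) _ δ fun i _ => hδB i
  rw [div_lt_iff₀ hδ] at hK
  linarith

/-- If bounded finitely additive set functions `μ n` tend to zero on every set of natural numbers,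
then `μ n {n}` tends to zero. -/
theorem tendsto_diagonal_of_finitelyAdditive {μ : ℕ → Set ℕ → ℝ}
    (hadd : ∀ n A B, Disjoint A B → μ n (A ∪ B) = μ n A + μ n B)
    (hbdd : ∀ n, ∃ C, ∀ A, |μ n A| ≤ C)
    (hlim : ∀ A, Tendsto (fun n => μ n A) atTop (𝓝 0)) :
    Tendsto (fun n => μ n {n}) atTop (𝓝 0) := by
  by_contra hcon
  obtain ⟨ε, hε, hfreq⟩ : ∃ ε > 0, ∃ᶠ n in atTop, ε ≤ |μ n {n}| := by
    simp only [Metric.tendsto_nhds, Real.dist_eq, sub_zero] at hcon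
    push Not at hcon
    exact hcon
  have hsmall : ∀ A, ∀ᶠ n in atTop, |μ n A| < ε / 3 := by
    intro A
    have := Metric.tendsto_nhds.1 (hlim A) (ε / 3) (by positivity)
    simpa [Real.dist_eq] using this
  -- A sliding-hump state `(F, j, M)`: earlier indices, current index, and reservoir of later ones.
  -- `μ j` is small on `F` and on every subset of `M`, but not on `{j}`.
  let Good : Set ℕ × ℕ × Set ℕ → Prop := fun s =>
    s.2.2.Infinite ∧ (∀ n ∈ s.2.2, ε ≤ |μ n {n}|) ∧ ε ≤ |μ s.2.1 {s.2.1}| ∧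
      Disjoint (insert s.2.1 s.1) s.2.2 ∧ s.2.1 ∉ s.1 ∧ |μ s.2.1 s.1| < ε / 3 ∧
      ∀ B ⊆ s.2.2, |μ s.2.1 B| < ε / 3
  have hpick : ∀ (F M : Set ℕ) (j : ℕ), M.Infinite → (∀ n ∈ M, ε ≤ |μ n {n}|) → Disjoint F M →
      ∃ j' M', j' ∈ M ∧ j < j' ∧ M' ⊆ M ∧ Good (F, j', M') := by
    intro F M j hM hMε hFM
    obtain ⟨j', ⟨hj'F, hjj'⟩, hj'M⟩ :=
      (((hsmall F).and (eventually_gt_atTop j)).and_frequently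
        (Nat.frequently_atTop_iff_infinite.2 hM)).exists
    obtain ⟨C, hC⟩ := hbdd j'
    obtain ⟨M', hM'M, hM', hB⟩ := exists_infinite_subset_forall_abs_lt (hadd j') hC
      (show 0 < ε / 3 by positivity) (hM.sdiff (Set.finite_singleton j'))
    refine ⟨j', M', hj'M, hjj', hM'M.trans Set.sdiff_subset, hM',
      fun n hn => hMε n (hM'M hn).1, hMε j' hj'M, ?_, ?_, hj'F, hB⟩
    · rw [Set.disjoint_left]
      rintro a (rfl | ha) haM
      · exact (hM'M haM).2 rfl
      · exact Set.disjoint_left.1 hFM ha (hM'M haM).1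
    · exact fun h => Set.disjoint_left.1 hFM h hj'M
  have hstep : ∀ s : {s // Good s}, ∃ t : {s // Good s}, t.1.1 = insert s.1.2.1 s.1.1 ∧
      t.1.2.1 ∈ s.1.2.2 ∧ s.1.2.1 < t.1.2.1 ∧ t.1.2.2 ⊆ s.1.2.2 := by
    rintro ⟨⟨F, j, M⟩, hM, hMε, -, hFM, -⟩
    obtain ⟨j', M', h1, h2, h3, h4⟩ := hpick (insert j F) M j hM hMε hFM
    exact ⟨⟨_, h4⟩, rfl, h1, h2, h3⟩
  obtain ⟨j₀, M₀, -, -, -, h₀⟩ := hpick ∅ {n | ε ≤ |μ n {n}|} 0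
    (Nat.frequently_atTop_iff_infinite.1 hfreq) (fun n hn => hn) (by simp)
  choose next hF hj hlt hM using hstep
  let s : ℕ → {s // Good s} := fun k => Nat.rec ⟨_, h₀⟩ (fun _ t => next t) k
  have hs : ∀ k, s (k + 1) = next (s k) := fun k => rfl
  let j : ℕ → ℕ := fun k => (s k).1.2.1
  have hmono : StrictMono j := strictMono_nat_of_lt_succ fun k => hlt (s k)
  have hFj : ∀ k, (s k).1.1 = j '' {i | i < k} := by
    intro k
    induction k with
    | zero => simp [s]
    | succ k ih =>
      rw [hs, hF, ih]
      ext a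
      simp only [Set.mem_insert_iff, Set.mem_image, Set.mem_ofPred_eq, Nat.lt_succ_iff_lt_or_eq]
      constructor
      · rintro (rfl | ⟨i, hi, rfl⟩)
        · exact ⟨k, Or.inr rfl, rfl⟩
        · exact ⟨i, Or.inl hi, rfl⟩
      · rintro ⟨i, hi | rfl, rfl⟩
        · exact Or.inr ⟨i, hi, rfl⟩
        · exact Or.inl rfl
  have hanti : Antitone fun k => (s k).1.2.2 := antitone_nat_of_succ_le fun k => hM (s k)
  have hjM : ∀ k, j '' {i | k < i} ⊆ (s k).1.2.2 := by
    rintro k _ ⟨i, hi, rfl⟩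
    obtain ⟨i, rfl⟩ : ∃ i', i = i' + 1 := ⟨i - 1, by have : k < i := hi; omega⟩
    exact hanti (Nat.lt_succ_iff.1 hi) (hj (s i))
  have hsplit : ∀ k, Set.range j = (j '' {i | i < k} ∪ {j k}) ∪ j '' {i | k < i} := by
    intro k
    rw [← Set.image_singleton, ← Set.image_union, ← Set.image_union, ← Set.image_univ]
    congr 1
    ext i
    simp only [Set.mem_univ, Set.mem_union, Set.mem_ofPred_eq, Set.mem_singleton_iff, true_iff]
    omega
  obtain ⟨k, hk⟩ := (hmono.tendsto_atTop.eventually (hsmall (Set.range j))).exists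
  obtain ⟨-, -, hεk, hdisj, hnot, hFk, hMk⟩ := (s k).2
  have h1 := hMk _ (hjM k)
  rw [hFj k] at hdisj hFk hnot
  -- On `Set.range j` the past, the future and the total are each below `ε / 3`, which forces `|μ (j
  -- k) {j k}| < ε`.
  rw [hsplit k, hadd, hadd] at hk
  · change ε ≤ |μ (j k) {j k}| at hεk
    change |μ (j k) _| < _ at h1
    change |μ (j k) _| < _ at hFk
    rw [abs_lt] at h1 hFk hk
    rcases le_abs.1 hεk with h | h <;> linarith [h1.1, h1.2, hFk.1, hFk.2, hk.1, hk.2]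
  · exact Set.disjoint_singleton_right.2 hnot
  · rw [Set.union_singleton]
    exact hdisj.mono_right (hjM k)

/-! ### Disjointness in lattice-ordered groups -/

section LatticeOrderedGroup

theorem inf_eq_zero_of_le {E : Type*} [AddCommGroup E] [Lattice E] {a b c d : E}
    (hc : 0 ≤ c) (hd : 0 ≤ d) (hca : c ≤ a) (hdb : d ≤ b) (h : a ⊓ b = 0) : c ⊓ d = 0 :=
  le_antisymm (h ▸ inf_le_inf hca hdb) (le_inf hc hd)

variable {E : Type*} [AddCommGroup E] [Lattice E] [IsOrderedAddMonoid E]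

/-- This is the Riesz decomposition: `z ⊓ a` and `z - z ⊓ a` split `z` into parts below `a` and `b`.
-/
theorem sub_inf_le_of_le_add {z a b : E} (hb : 0 ≤ b) (h : z ≤ a + b) : z - z ⊓ a ≤ b := by
  rw [sub_le_comm]
  exact le_inf (sub_le_self z hb) (sub_le_iff_le_add.2 h)

theorem add_inf_eq_zero {a b c : E} (ha : 0 ≤ a) (hb : 0 ≤ b) (hc : 0 ≤ c) (hac : a ⊓ c = 0)
    (hbc : b ⊓ c = 0) : (a + b) ⊓ c = 0 := by
  refine le_antisymm ?_ (le_inf (add_nonneg ha hb) hc)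
  have h0 : (a + b) ⊓ c ⊓ a = 0 :=
    le_antisymm (hac ▸ le_inf inf_le_right (inf_le_left.trans inf_le_right))
      (le_inf (le_inf (add_nonneg ha hb) hc) ha)
  have h1 := sub_inf_le_of_le_add hb (inf_le_left : (a + b) ⊓ c ≤ a + b)
  rw [h0, sub_zero] at h1
  exact hbc ▸ le_inf h1 inf_le_right

theorem nsmul_inf_eq_zero {a b : E} (ha : 0 ≤ a) (hb : 0 ≤ b) (h : a ⊓ b = 0) (n : ℕ) :
    (n • a) ⊓ b = 0 := by
  induction n with
  | zero => simpa using hb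
  | succ n ih =>
    rw [succ_nsmul]
    exact add_inf_eq_zero (nsmul_nonneg ha n) ha hb ih h

theorem nsmul_inf_nsmul_eq_zero {a b : E} (ha : 0 ≤ a) (hb : 0 ≤ b) (h : a ⊓ b = 0) (m n : ℕ) :
    (m • a) ⊓ (n • b) = 0 := by
  rw [inf_comm]
  refine nsmul_inf_eq_zero hb (nsmul_nonneg ha m) ?_ n
  rw [inf_comm]
  exact nsmul_inf_eq_zero ha hb h m

theorem sup_eq_add_of_inf_eq_zero {a b : E} (h : a ⊓ b = 0) : a ⊔ b = a + b := by
  rw [← inf_add_sup a b, h, zero_add]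

theorem IsLUB.inf_eq_zero {s : Set E} {a b : E} (ha : IsLUB s a) (ha0 : 0 ≤ a) (hb : 0 ≤ b)
    (hs : ∀ z ∈ s, 0 ≤ z) (h : ∀ z ∈ s, z ⊓ b = 0) : a ⊓ b = 0 := by
  refine le_antisymm ?_ (le_inf ha0 hb)
  -- Each `z ∈ s` is disjoint from `a ⊓ b`, so `z + a ⊓ b = z ⊔ (a ⊓ b) ≤ a`.
  have hub : a ≤ a - a ⊓ b := by
    refine ha.2 fun z hz => ?_
    rw [le_sub_iff_add_le, ← sup_eq_add_of_inf_eq_zero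
      (inf_eq_zero_of_le (hs z hz) (le_inf ha0 hb) le_rfl inf_le_right (h z hz))]
    exact sup_le (ha.1 hz) inf_le_left
  simpa using hub

/-- In a `σ`-Dedekind complete lattice-ordered group, a positive disjoint order bounded sequence
has partial suprema over all sets of indices, and these are finitely additive. -/
theorem SigmaDedekindComplete.exists_additive_sup (hE : SigmaDedekindComplete E) {z : ℕ → E}
    {x : E} (hz : ∀ n, 0 ≤ z n) (hzx : ∀ n, z n ≤ x) (hd : Pairwise fun m n => z m ⊓ z n = 0) :
    ∃ s : Set ℕ → E, (∀ A, 0 ≤ s A) ∧ (∀ A, s A ≤ x) ∧ (∀ n, s {n} = z n) ∧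
      ∀ A B, Disjoint A B → s (A ∪ B) = s A + s B := by
  have hx : 0 ≤ x := (hz 0).trans (hzx 0)
  -- Inserting `0` covers the empty set of indices and changes no other supremum.
  have hex : ∀ A : Set ℕ, ∃ a, IsLUB (insert 0 (z '' A)) a := fun A =>
    hE _ ((A.to_countable.image z).insert 0) (Set.insert_nonempty _ _) ⟨x, by
      rintro _ (rfl | ⟨n, -, rfl⟩)
      exacts [hx, hzx n]⟩
  choose s hs using hex
  have hnn : ∀ A : Set ℕ, ∀ y ∈ insert 0 (z '' A), 0 ≤ y := by
    rintro A _ (rfl | ⟨n, -, rfl⟩)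
    exacts [le_rfl, hz n]
  have hs0 : ∀ A, 0 ≤ s A := fun A => (hs A).1 (Set.mem_insert _ _)
  refine ⟨s, hs0, fun A => (hs A).2 ?_, fun n => ?_, fun A B hAB => ?_⟩
  · rintro _ (rfl | ⟨n, -, rfl⟩)
    exacts [hx, hzx n]
  · refine (hs {n}).unique ⟨?_, fun y hy => hy (by simp)⟩
    rintro _ (rfl | ⟨m, rfl, rfl⟩)
    exacts [hz n, le_rfl]
  · have hdisj : s A ⊓ s B = 0 := by
      refine (hs A).inf_eq_zero (hs0 A) (hs0 B) (hnn A) ?_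
      rintro y hy
      rw [inf_comm]
      refine (hs B).inf_eq_zero (hs0 B) (hnn A y hy) (hnn B) ?_
      rintro w hw
      rcases hy with rfl | ⟨m, hm, rfl⟩
      · exact inf_eq_right.2 (hnn B w hw)
      · rcases hw with rfl | ⟨n, hn, rfl⟩
        · exact inf_eq_left.2 (hz m)
        · exact hd fun h => Set.disjoint_left.1 hAB hm (h ▸ hn)
    rw [← sup_eq_add_of_inf_eq_zero hdisj]
    refine (hs (A ∪ B)).unique ?_
    have := (hs A).union (hs B)
    rwa [← Set.insert_union_distrib, ← Set.image_union] at this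

end LatticeOrderedGroup

/-! ### Weak* null sequences, weakly `p`-summable sequences and limited sets -/

section Dual

variable {E : Type*} [NormedAddCommGroup E] [NormedSpace ℝ E]

theorem weakStarNull_iff {f : ℕ → StrongDual ℝ E} :
    WeakStarNull f ↔ ∀ x, Tendsto (fun n => f n x) atTop (𝓝 0) :=
  tendsto_iff_forall_eval_tendsto_topDualPairing

theorem WeakStarNull.comp {f : ℕ → StrongDual ℝ E} (hf : WeakStarNull f) {φ : ℕ → ℕ}
    (hφ : StrictMono φ) : WeakStarNull (f ∘ φ) :=
  Tendsto.comp (f := φ) (g := fun n => StrongDual.toWeakDual (f n)) hf hφ.tendsto_atTop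

theorem WeakStarNull.neg {f : ℕ → StrongDual ℝ E} (hf : WeakStarNull f) : WeakStarNull (-f) := by
  rw [weakStarNull_iff] at hf ⊢
  intro x
  simpa using (hf x).neg

theorem WeaklyPSummable.comp {p : ℝ} {x : ℕ → E} (hx : WeaklyPSummable p x) {φ : ℕ → ℕ}
    (hφ : StrictMono φ) : WeaklyPSummable p (x ∘ φ) :=
  fun f => (hx f).comp_injective hφ.injective

theorem WeaklyPSummable.isBounded_range {p : ℝ} (hp : 1 ≤ p) {x : ℕ → E}
    (hx : WeaklyPSummable p x) : Bornology.IsBounded (Set.range x) := by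
  obtain ⟨C, hC⟩ : ∃ C, ∀ n, ‖NormedSpace.inclusionInDoubleDualLi ℝ (x n)‖ ≤ C := by
    -- Uniform boundedness is applied on the dual, with the `x n` acting as functionals.
    refine banach_steinhaus fun f => ?_
    obtain ⟨C, hC⟩ := (hx f).tendsto_atTop_zero.bddAbove_range
    refine ⟨max 1 C, fun n => ?_⟩
    change |f (x n)| ≤ _
    have h1 : |f (x n)| ^ p ≤ C := hC ⟨n, rfl⟩
    rcases le_total |f (x n)| 1 with h | h
    · exact h.trans (le_max_left _ _)
    · refine le_trans ?_ (h1.trans (le_max_right _ _))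
      exact Real.self_le_rpow_of_one_le h hp
  refine isBounded_iff_forall_norm_le.2 ⟨C, ?_⟩
  rintro _ ⟨n, rfl⟩
  exact ((NormedSpace.inclusionInDoubleDualLi ℝ).norm_map (x n)).symm.trans_le (hC n)

theorem TendstoUniformlyOn.tendsto_diagonal {x : ℕ → E} {f : ℕ → StrongDual ℝ E}
    (h : TendstoUniformlyOn (fun n y => f n y) (fun _ => 0) atTop (Set.range x)) :
    Tendsto (fun n => f n (x n)) atTop (𝓝 0) := by
  rw [Metric.tendsto_nhds]
  intro ε hε
  filter_upwards [Metric.tendstoUniformlyOn_iff.1 h ε hε] with n hn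
  rw [dist_comm]
  exact hn _ ⟨n, rfl⟩

/-- A sequence is limited as soon as its subsequences vanish along all weak* null sequences. -/
theorem isLimitedSet_range_of_subseq {x : ℕ → E}
    (h : ∀ φ : ℕ → ℕ, StrictMono φ → ∀ f : ℕ → StrongDual ℝ E, WeakStarNull f →
      Tendsto (fun n => f n (x (φ n))) atTop (𝓝 0)) : IsLimitedSet (Set.range x) := by
  intro f hf
  rw [Metric.tendstoUniformlyOn_iff]
  by_contra! hcon
  obtain ⟨ε, hε, hfreq⟩ := hcon
  have hnext : ∀ q : ℕ × ℕ, ∃ r : ℕ × ℕ, q.1 < r.1 ∧ q.2 < r.2 ∧ ε ≤ |f r.1 (x r.2)| := by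
    rintro ⟨N, K⟩
    -- Pointwise convergence rules out the finitely many `k ≤ K`, so a witness with large `n` must
    -- have a new index `k > K`.
    have hsmall : ∀ᶠ n in atTop, ∀ k ∈ Finset.range (K + 1), |f n (x k)| < ε := by
      rw [eventually_all_finset]
      intro k _
      simpa [Real.dist_eq] using Metric.tendsto_nhds.1 (weakStarNull_iff.1 hf (x k)) ε hε
    obtain ⟨n, ⟨hn, hNn⟩, _, ⟨k, rfl⟩, hk⟩ :=
      ((hsmall.and (eventually_gt_atTop N)).and_frequently hfreq).exists
    have hk' : ε ≤ |f n (x k)| := by simpa [Real.dist_eq] using hk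
    refine ⟨(n, k), hNn, ?_, hk'⟩
    by_contra hKk
    exact absurd (hn k (Finset.mem_range.2 (by simp at hKk; omega))) (not_lt.2 hk')
  choose next h1 h2 h3 using hnext
  let q : ℕ → ℕ × ℕ := fun i => Nat.rec (next (0, 0)) (fun _ r => next r) i
  have hq : ∀ i, ε ≤ |f (q i).1 (x (q i).2)| := by
    rintro (_ | i)
    exacts [h3 _, h3 _]
  have hq1 : StrictMono fun i => (q i).1 := strictMono_nat_of_lt_succ fun i => h1 (q i)
  have hq2 : StrictMono fun i => (q i).2 := strictMono_nat_of_lt_succ fun i => h2 (q i)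
  have hlim := h _ hq2 _ (hf.comp hq1)
  obtain ⟨i, hi⟩ := (Metric.tendsto_nhds.1 hlim ε hε).exists
  rw [Real.dist_eq, sub_zero] at hi
  exact absurd hi (not_lt.2 (hq i))

end Dual

/-! ### Restricting a functional to a principal ideal -/

section BanachLattice

variable {E : Type*} [NormedAddCommGroup E] [Lattice E]

/-- The positive elements below `x` of the ideal generated by `y`. -/
def idealInterval (y x : E) : Set E := {z | 0 ≤ z ∧ z ≤ x ∧ ∃ n : ℕ, z ≤ n • y}

theorem zero_mem_idealInterval {y x : E} (hx : 0 ≤ x) : (0 : E) ∈ idealInterval y x :=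
  ⟨le_rfl, hx, 0, by simp⟩

theorem mem_idealInterval_self {y : E} (hy : 0 ≤ y) : y ∈ idealInterval y y :=
  ⟨hy, le_rfl, 1, by simp⟩

variable [IsOrderedAddMonoid E]

theorem idealInterval_eq_singleton {y w x : E} (hy : 0 ≤ y) (hw : 0 ≤ w) (hx : 0 ≤ x)
    (h : y ⊓ w = 0) {n : ℕ} (hxw : x ≤ n • w) : idealInterval y x = {0} := by
  refine Set.Subset.antisymm ?_ (Set.singleton_subset_iff.2 (zero_mem_idealInterval hx))
  rintro z ⟨hz, hzx, m, hzm⟩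
  exact le_antisymm (nsmul_inf_nsmul_eq_zero hy hw h m n ▸ le_inf hzm (hzx.trans hxw)) hz

variable [NormedSpace ℝ E]

/-- The supremum of `f` over the elements of the ideal generated by `y` lying between
`0` and `x`. -/
noncomputable def idealSup (f : StrongDual ℝ E) (y x : E) : ℝ := sSup (f '' idealInterval y x)

theorem isLUB_self_neg {f : StrongDual ℝ E} (hf : 0 ≤ f) : IsLUB {f, -f} f := by
  refine ⟨?_, fun g hg => hg (by simp)⟩
  rintro g (rfl | rfl)
  · exact le_rfl
  · intro x hx
    have : 0 ≤ f x := hf x hx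
    change -f x ≤ f x
    linarith

variable [HasSolidNorm E]

theorem abs_apply_le_of_mem_Icc (f : StrongDual ℝ E) {x z : E} (hz : 0 ≤ z) (hzx : z ≤ x) :
    |f z| ≤ ‖f‖ * ‖x‖ := by
  refine (f.le_opNorm z).trans (mul_le_mul_of_nonneg_left ?_ (norm_nonneg f))
  refine norm_le_norm_of_abs_le_abs ?_
  rwa [abs_of_nonneg hz, abs_of_nonneg (hz.trans hzx)]

theorem isLUB_idealSup (f : StrongDual ℝ E) {y x : E} (hx : 0 ≤ x) :
    IsLUB (f '' idealInterval y x) (idealSup f y x) := by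
  refine isLUB_csSup ⟨_, Set.mem_image_of_mem f (zero_mem_idealInterval hx)⟩ ⟨‖f‖ * ‖x‖, ?_⟩
  rintro _ ⟨z, ⟨hz, hzx, -⟩, rfl⟩
  exact (le_abs_self _).trans (abs_apply_le_of_mem_Icc f hz hzx)

theorem apply_le_idealSup (f : StrongDual ℝ E) {y x z : E} (hz : z ∈ idealInterval y x) :
    f z ≤ idealSup f y x :=
  (isLUB_idealSup f (hz.1.trans hz.2.1)).1 ⟨z, hz, rfl⟩

theorem idealSup_nonneg (f : StrongDual ℝ E) {y x : E} (hx : 0 ≤ x) : 0 ≤ idealSup f y x := by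
  simpa using apply_le_idealSup f (zero_mem_idealInterval (y := y) hx)

theorem idealSup_le (f : StrongDual ℝ E) {y x : E} (hx : 0 ≤ x) :
    idealSup f y x ≤ ‖f‖ * ‖x‖ := by
  refine (isLUB_idealSup f hx).2 ?_
  rintro _ ⟨z, ⟨hz, hzx, -⟩, rfl⟩
  exact (le_abs_self _).trans (abs_apply_le_of_mem_Icc f hz hzx)

/-- As in the Riesz-Kantorovich formula, `≤` comes from Riesz decomposition and `≥` from adding
elements of the two intervals. -/
theorem idealSup_add (f : StrongDual ℝ E) {y a b : E} (ha : 0 ≤ a) (hb : 0 ≤ b) :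
    idealSup f y (a + b) = idealSup f y a + idealSup f y b := by
  apply le_antisymm
  · refine (isLUB_idealSup f (add_nonneg ha hb)).2 ?_
    rintro _ ⟨z, ⟨hz, hzab, n, hzn⟩, rfl⟩
    have h1 : z ⊓ a ∈ idealInterval y a := ⟨le_inf hz ha, inf_le_right, n, inf_le_left.trans hzn⟩
    have h2 : z - z ⊓ a ∈ idealInterval y b :=
      ⟨sub_nonneg.2 inf_le_left, sub_inf_le_of_le_add hb hzab, n,
        (sub_le_self z (le_inf hz ha)).trans hzn⟩
    have := add_le_add (apply_le_idealSup f h1) (apply_le_idealSup f h2)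
    rwa [← map_add, add_sub_cancel] at this
  · rw [← le_sub_iff_add_le]
    refine (isLUB_idealSup f ha).2 ?_
    rintro _ ⟨z, ⟨hz, hza, n, hzn⟩, rfl⟩
    rw [le_sub_comm]
    refine (isLUB_idealSup f hb).2 ?_
    rintro _ ⟨w, ⟨hw, hwb, m, hwm⟩, rfl⟩
    rw [le_sub_iff_add_le, ← map_add]
    exact apply_le_idealSup f ⟨add_nonneg hw hz,
      by rw [add_comm a b]; exact add_le_add hwb hza, m + n,
      by rw [add_nsmul]; exact add_le_add hwm hzn⟩

/-- This makes the additive extension independent of how a vector is written as a difference of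
positive elements. -/
theorem idealSup_sub_idealSup (f : StrongDual ℝ E) {y a b c d : E} (ha : 0 ≤ a) (hb : 0 ≤ b)
    (hc : 0 ≤ c) (hd : 0 ≤ d) (h : a - b = c - d) :
    idealSup f y a - idealSup f y b = idealSup f y c - idealSup f y d := by
  have h1 : a + d = c + b := by rwa [sub_eq_sub_iff_add_eq_add] at h
  have h2 := congrArg (idealSup f y) h1
  rw [idealSup_add f ha hd, idealSup_add f hc hb] at h2
  linarith

/-- The additive extension of `idealSup f y` to the whole space. -/
noncomputable def idealPosPartHom (f : StrongDual ℝ E) (y : E) : E →+ ℝ :=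
  AddMonoidHom.mk' (fun x => idealSup f y x⁺ - idealSup f y x⁻) fun a b => by
    rw [← add_sub_add_comm, ← idealSup_add f (posPart_nonneg a) (posPart_nonneg b),
      ← idealSup_add f (negPart_nonneg a) (negPart_nonneg b)]
    refine idealSup_sub_idealSup f (posPart_nonneg _) (negPart_nonneg _)
      (add_nonneg (posPart_nonneg a) (posPart_nonneg b))
      (add_nonneg (negPart_nonneg a) (negPart_nonneg b)) ?_
    rw [posPart_sub_negPart, add_sub_add_comm, posPart_sub_negPart, posPart_sub_negPart]

theorem norm_idealPosPartHom_le (f : StrongDual ℝ E) (y x : E) :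
    ‖idealPosPartHom f y x‖ ≤ ‖f‖ * ‖x‖ := by
  change |idealSup f y x⁺ - idealSup f y x⁻| ≤ _
  have h1 := idealSup_le f (y := y) (abs_nonneg x)
  rw [norm_abs_eq_norm, ← posPart_add_negPart,
    idealSup_add f (posPart_nonneg x) (negPart_nonneg x)] at h1
  have h2 := idealSup_nonneg f (y := y) (posPart_nonneg x)
  have h3 := idealSup_nonneg f (y := y) (negPart_nonneg x)
  rw [abs_le]
  constructor <;> linarith

/-- The positive functional equal to the positive part of `f` on the ideal generated by `y`, and
minimal with this property. -/
noncomputable def idealPosPart (f : StrongDual ℝ E) (y : E) : StrongDual ℝ E :=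
  (idealPosPartHom f y).toRealLinearMap
    (AddMonoidHomClass.continuous_of_bound _ ‖f‖ (norm_idealPosPartHom_le f y))

theorem idealPosPart_apply (f : StrongDual ℝ E) (y : E) {x : E} (hx : 0 ≤ x) :
    idealPosPart f y x = idealSup f y x := by
  change idealSup f y x⁺ - idealSup f y x⁻ = _
  have h0 : idealSup f y (0 : E) = 0 := by
    simpa using idealSup_add f (y := y) (le_refl (0 : E)) (le_refl 0)
  rw [posPart_of_nonneg hx, negPart_of_nonneg hx, h0, sub_zero]

theorem idealPosPart_nonneg (f : StrongDual ℝ E) (y : E) : 0 ≤ idealPosPart f y := by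
  intro x hx
  rw [idealPosPart_apply f y hx]
  exact idealSup_nonneg f hx

theorem idealPosPart_eq_zero (f : StrongDual ℝ E) {y w x : E} (hy : 0 ≤ y) (hw : 0 ≤ w)
    (h : y ⊓ w = 0) (hx : 0 ≤ x) {n : ℕ} (hxw : x ≤ n • w) : idealPosPart f y x = 0 := by
  rw [idealPosPart_apply f y hx, idealSup, idealInterval_eq_singleton hy hw hx h hxw]
  simp

theorem dualDisjoint_idealPosPart (f g : StrongDual ℝ E) {y w : E} (hy : 0 ≤ y) (hw : 0 ≤ w)
    (h : y ⊓ w = 0) : DualDisjoint (idealPosPart f y) (idealPosPart g w) := by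
  refine ⟨_, _, isLUB_self_neg (idealPosPart_nonneg f y),
    isLUB_self_neg (idealPosPart_nonneg g w), ?_, ?_⟩
  · rintro k (rfl | rfl)
    exacts [idealPosPart_nonneg f y, idealPosPart_nonneg g w]
  · intro k hk x hx
    have hkf : k ≤ idealPosPart f y := hk (by simp)
    have hkg : k ≤ idealPosPart g w := hk (by simp)
    change k x ≤ 0
    -- Split `x = z + (x - z)` with `f z` within `ε` of the supremum: the functional for `w`
    -- vanishes at `z`, and the one for `y` is below `ε` at `x - z`.
    refine le_of_forall_pos_le_add fun ε hε => ?_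
    obtain ⟨_, ⟨z, hz, rfl⟩, hzε, -⟩ :=
      (isLUB_idealSup f (y := y) hx).exists_between (sub_lt_self _ hε)
    have hxz : 0 ≤ x - z := sub_nonneg.2 hz.2.1
    obtain ⟨n, hn⟩ := hz.2.2
    have h1 : k z ≤ 0 := (hkg z hz.1).trans_eq
      (idealPosPart_eq_zero g hw hy (by rwa [inf_comm]) hz.1 hn)
    have h2 := hkf (x - z) hxz
    have h3 : f z ≤ idealPosPart f y z := by
      rw [idealPosPart_apply f y hz.1]
      exact apply_le_idealSup f ⟨hz.1, le_rfl, n, hn⟩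
    rw [map_sub, map_sub, idealPosPart_apply f y hx] at h2
    linarith

/-- On a `σ`-Dedekind complete Banach lattice, restricting a weak* null sequence to the ideals
generated by a positive disjoint sequence gives positive parts that are again weak* null. -/
theorem SigmaDedekindComplete.weakStarNull_idealPosPart (hE : SigmaDedekindComplete E)
    {f : ℕ → StrongDual ℝ E} (hf : WeakStarNull f) {y : ℕ → E} (hy : ∀ n, 0 ≤ y n)
    (hd : Pairwise fun m n => y m ⊓ y n = 0) :
    WeakStarNull fun n => idealPosPart (f n) (y n) := by
  have hpos : ∀ x : E, 0 ≤ x → Tendsto (fun n => idealPosPart (f n) (y n) x) atTop (𝓝 0) := by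
    intro x hx
    have hz : ∀ n : ℕ, ∃ z ∈ idealInterval (y n) x,
        idealPosPart (f n) (y n) x ≤ f n z + 1 / ((n : ℝ) + 1) := by
      intro n
      obtain ⟨_, ⟨z, hz, rfl⟩, hzε, -⟩ := (isLUB_idealSup (f n) (y := y n) hx).exists_between
        (sub_lt_self _ (Nat.one_div_pos_of_nat (α := ℝ) (n := n)))
      refine ⟨z, hz, ?_⟩
      rw [idealPosPart_apply _ _ hx]
      linarith
    choose z hz hzf using hz
    have hzd : Pairwise fun m n => z m ⊓ z n = 0 := by
      intro m n hmn
      obtain ⟨a, ha⟩ := (hz m).2.2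
      obtain ⟨b, hb⟩ := (hz n).2.2
      exact inf_eq_zero_of_le (hz m).1 (hz n).1 ha hb
        (nsmul_inf_nsmul_eq_zero (hy m) (hy n) (hd hmn) a b)
    obtain ⟨s, hs0, hsx, hsz, hadd⟩ :=
      hE.exists_additive_sup (fun n => (hz n).1) (fun n => (hz n).2.1) hzd
    have hlim : Tendsto (fun n => f n (z n)) atTop (𝓝 0) := by
      have := tendsto_diagonal_of_finitelyAdditive (μ := fun n A => f n (s A))
        (fun n A B hAB => by rw [hadd A B hAB, map_add])
        (fun n => ⟨‖f n‖ * ‖x‖, fun A => abs_apply_le_of_mem_Icc (f n) (hs0 A) (hsx A)⟩)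
        (fun A => weakStarNull_iff.1 hf (s A))
      simpa only [hsz] using this
    refine squeeze_zero (fun n => idealPosPart_nonneg (f n) (y n) x hx) hzf ?_
    simpa using hlim.add (tendsto_one_div_add_atTop_nhds_zero_nat (𝕜 := ℝ))
  rw [weakStarNull_iff]
  intro x
  have := (hpos _ (posPart_nonneg x)).sub (hpos _ (negPart_nonneg x))
  simpa only [← map_sub, posPart_sub_negPart, sub_zero] using this

end BanachLattice

/-! ### The characterization -/

section Characterization

theorem DisjointSeq.comp {E : Type*} [AddCommGroup E] [Lattice E] {x : ℕ → E}
    (hx : DisjointSeq x) {φ : ℕ → ℕ} (hφ : StrictMono φ) : DisjointSeq (x ∘ φ) :=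
  fun _ _ hmn => hx (hφ.injective.ne hmn)

theorem DisjointSeq.neg {E : Type*} [AddCommGroup E] [Lattice E] {x : ℕ → E}
    (hx : DisjointSeq x) : DisjointSeq (-x) := by
  intro m n hmn
  simpa using hx hmn

theorem DisjointSeq.posPart_inf_eq_zero {E : Type*} [AddCommGroup E] [Lattice E]
    [IsOrderedAddMonoid E] {x : ℕ → E} (hx : DisjointSeq x) :
    Pairwise fun m n => (x m)⁺ ⊓ (x n)⁺ = 0 := by
  intro m n hmn
  exact inf_eq_zero_of_le (posPart_nonneg _) (posPart_nonneg _)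
    (sup_le (le_abs_self _) (abs_nonneg _)) (sup_le (le_abs_self _) (abs_nonneg _)) (hx hmn)

variable {E : Type*} [NormedAddCommGroup E] [Lattice E] [IsOrderedAddMonoid E] [NormedSpace ℝ E]

/-- `x` is annihilated along every positive disjoint weak* null sequence of functionals. -/
def DiagonalNull (x : ℕ → E) : Prop :=
  ∀ f : ℕ → StrongDual ℝ E, (∀ n, 0 ≤ f n) → DisjointDualSeq f → WeakStarNull f →
    Tendsto (fun n => f n (x n)) atTop (𝓝 0)

theorem DiagonalNull.neg {x : ℕ → E} (hx : DiagonalNull x) : DiagonalNull (-x) := by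
  intro f h1 h2 h3
  simpa using (hx f h1 h2 h3).neg

variable [HasSolidNorm E]

/-- The majorizing functionals kill `(x n)⁻`, so they can be tested on `x n` itself; the hypothesis
is never needed for the sequence of positive parts. -/
theorem DiagonalNull.exists_majorant (hE : SigmaDedekindComplete E) {x : ℕ → E}
    (hd : DisjointSeq x) (hx : DiagonalNull x) {f : ℕ → StrongDual ℝ E} (hf : WeakStarNull f) :
    ∃ b : ℕ → ℝ, Tendsto b atTop (𝓝 0) ∧ ∀ n, f n (x n)⁺ ≤ b n := by
  refine ⟨fun n => idealPosPart (f n) (x n)⁺ (x n), hx _ (fun n => idealPosPart_nonneg _ _)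
    (fun m n hmn => dualDisjoint_idealPosPart _ _ (posPart_nonneg _) (posPart_nonneg _)
      (hd.posPart_inf_eq_zero hmn))
    (hE.weakStarNull_idealPosPart hf (fun n => posPart_nonneg _) hd.posPart_inf_eq_zero),
    fun n => ?_⟩
  have h1 : idealPosPart (f n) (x n)⁺ (x n)⁻ = 0 :=
    idealPosPart_eq_zero (f n) (posPart_nonneg _) (negPart_nonneg _)
      (posPart_inf_negPart_eq_zero _) (negPart_nonneg _) (n := 1) (by simp)
  have h2 : idealPosPart (f n) (x n)⁺ (x n) = idealPosPart (f n) (x n)⁺ (x n)⁺ := by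
    conv_lhs => rw [← posPart_sub_negPart (x n), map_sub]
    rw [posPart_sub_negPart, h1, sub_zero]
  change _ ≤ idealPosPart (f n) (x n)⁺ (x n)
  rw [h2, idealPosPart_apply _ _ (posPart_nonneg _)]
  exact apply_le_idealSup _ (mem_idealInterval_self (posPart_nonneg _))

theorem DiagonalNull.tendsto_posPart (hE : SigmaDedekindComplete E) {x : ℕ → E}
    (hd : DisjointSeq x) (hx : DiagonalNull x) {f : ℕ → StrongDual ℝ E} (hf : WeakStarNull f) :
    Tendsto (fun n => f n (x n)⁺) atTop (𝓝 0) := by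
  obtain ⟨b, hb, hfb⟩ := hx.exists_majorant hE hd hf
  -- The majorant for `-f` supplies the lower bound.
  obtain ⟨c, hc, hfc⟩ := hx.exists_majorant hE hd hf.neg
  refine tendsto_of_tendsto_of_tendsto_of_le_of_le (by simpa using hc.neg) hb (fun n => ?_) hfb
  have : -(f n (x n)⁺) ≤ c n := hfc n
  change -c n ≤ _
  linarith

theorem DiagonalNull.tendsto (hE : SigmaDedekindComplete E) {x : ℕ → E}
    (hd : DisjointSeq x) (hx : DiagonalNull x) {f : ℕ → StrongDual ℝ E} (hf : WeakStarNull f) :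
    Tendsto (fun n => f n (x n)) atTop (𝓝 0) := by
  have h1 := hx.tendsto_posPart hE hd hf
  have h2 := hx.neg.tendsto_posPart hE hd.neg hf
  have := h1.sub h2
  simpa only [Pi.neg_apply, posPart_neg, ← map_sub, posPart_sub_negPart, sub_zero] using this

end Characterization

theorem theorem3p4 {E : Type*} [NormedAddCommGroup E] [Lattice E] [IsOrderedAddMonoid E]
    [NormedSpace ℝ E] [IsOrderedModule ℝ E] [HasSolidNorm E] [CompleteSpace E]
    (hE : SigmaDedekindComplete E) (p : ℝ) (hp : 1 ≤ p) :
    List.TFAE [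
      DisjointDPStarP p E,
      ∀ x : ℕ → E, DisjointSeq x → WeaklyPSummable p x → IsAlmostLimitedSet (Set.range x),
      ∀ x : ℕ → E, DisjointSeq x → WeaklyPSummable p x →
        ∀ f : ℕ → StrongDual ℝ E, DisjointDualSeq f → WeakStarNull f →
          Tendsto (fun n => f n (x n)) atTop (𝓝 0),
      ∀ x : ℕ → E, DisjointSeq x → WeaklyPSummable p x →
        ∀ f : ℕ → StrongDual ℝ E, (∀ n, 0 ≤ f n) → DisjointDualSeq f → WeakStarNull f →
          Tendsto (fun n => f n (x n)) atTop (𝓝 0),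
      ∀ x : ℕ → E, DisjointSeq x → WeaklyPSummable p x →
        ∀ f : ℕ → StrongDual ℝ E, (∀ n, 0 ≤ f n) → WeakStarNull f →
          Tendsto (fun n => f n (x n)) atTop (𝓝 0)] := by
  tfae_have 1 → 2 := fun h x hd hx => ⟨hx.isBounded_range hp, fun f _ hf => h x hd hx f hf⟩
  tfae_have 2 → 3 := fun h x hd hx f hfd hf => ((h x hd hx).2 f hfd hf).tendsto_diagonal
  tfae_have 3 → 4 := fun h x hd hx f _ hfd hf => h x hd hx f hfd hf
  tfae_have 4 → 1 := fun h x hd hx => isLimitedSet_range_of_subseq fun φ hφ f hf =>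
    DiagonalNull.tendsto hE (hd.comp hφ) (h _ (hd.comp hφ) (hx.comp hφ)) hf
  tfae_have 1 → 5 := fun h x hd hx f _ hf => (h x hd hx f hf).tendsto_diagonal
  tfae_have 5 → 4 := fun h x hd hx f hpos _ hf => h x hd hx f hpos hf
  tfae_finish
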